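/- Let $(M^n,g)$ be a connected smooth Riemannian manifold without boundary. An end $e$ of $M$ is a compatible choice of a connected component $e(K)$ of $M\setminus K$ for every compact $K\subset M$ (with $e(L)\subseteq e(K)$ for $K\subseteq L$); the sets $e(K)$ are its neighbourhoods of infinity. Say that $(M,g)$ has positive ends if $M$ has at least two ends and each end has a neighbourhood foliated by smooth compact connected hypersurfaces $\Sigma_s=\{t=s\}$, $s>0$ (level sets of a smooth function $t$ without critical points, with $\{a\le t\le b\}$ compact for $0<a\le b$, and $t\to\infty$ along the end), of positive mean curvature with respect to the normal $\nabla t/|\nabla t|$, which points towards the end. Fix an end $E$ of $M$, and compactify every other end $E_k$ by a point $\infty_k$. A marginally trapped region is an open set $R$ that contains all the points $\infty_k$, that is disjoint from some neighbourhood of infinity of $E$, and whose boundary $\Sigma=\partial R$ is compact and smooth (near each of its points $R$ is $\{f<0\}$ for a smooth $f$ with $df\neq0$) and has nonpositive mean curvature with respect to the normal $\nabla f/|\nabla f|$ pointing out of $R$. Let $\mathscr R$ be the set of all marginally trapped regions. The apparent horizon of $(M,g)$ with respect to $E$ is the part $\Sigma^*$ of $\partial\big(\overline{\bigcup\mathscr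 R}\big)$ that faces $E$, namely $\Sigma^*=\partial W$, where $W$ is the connected component of $M\setminus\overline{\bigcup\mathscr R}$ that contains a neighbourhood of infinity of $E$; it is required to be nonempty and compact and to enclose $E$, i.e. to separate $E$ from every other end. **Theorem.** If $(M,g)$ has positive ends, then for every end $E$ of $M$ it has an apparent horizon: $\overline{\bigcup\mathscr R}$ misses a neighbourhood of infinity of $E$, the component $W$ exists, and $\Sigma^*=\partial W\subseteq\partial\big(\overline{\bigcup\mathscr R}\big)$ is nonempty, compact, and separates $E$ from every other end. -/

import Mathlib

open Set
open scoped Manifold ContDiff Topology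

noncomputable section

/-! ### Mean curvature of level sets in coordinates

`G` is the matrix field of a metric on (an open subset of) `ℝⁿ`, `F` a real function. -/

section Coordinates

/-- The partial derivative `∂ᵢ F` of a function on `ℝⁿ`. -/
def coordPartial {n : ℕ} (i : Fin n) (F : EuclideanSpace ℝ (Fin n) → ℝ)
    (y : EuclideanSpace ℝ (Fin n)) : ℝ :=
  fderiv ℝ F y (EuclideanSpace.single i 1)

/-- The Christoffel symbol
`Γᵏᵢⱼ = ½ ∑ₗ Gᵏˡ (∂ᵢ Gⱼₗ + ∂ⱼ Gᵢₗ - ∂ₗ Gᵢⱼ)` of the Levi-Civita connection. -/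
def christoffel {n : ℕ} (G : EuclideanSpace ℝ (Fin n) → Matrix (Fin n) (Fin n) ℝ)
    (k i j : Fin n) (y : EuclideanSpace ℝ (Fin n)) : ℝ :=
  (1 / 2 : ℝ) * ∑ l, (G y)⁻¹ k l *
    (coordPartial i (fun z => G z j l) y + coordPartial j (fun z => G z i l) y
      - coordPartial l (fun z => G z i j) y)

/-- The covariant Hessian `∂ᵢ∂ⱼ F - ∑ₖ Γᵏᵢⱼ ∂ₖ F`. -/
def coordHessian {n : ℕ} (G : EuclideanSpace ℝ (Fin n) → Matrix (Fin n) (Fin n) ℝ)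
    (F : EuclideanSpace ℝ (Fin n) → ℝ) (i j : Fin n) (y : EuclideanSpace ℝ (Fin n)) : ℝ :=
  coordPartial i (coordPartial j F) y - ∑ k, christoffel G k i j y * coordPartial k F y

/-- The gradient components `∑ⱼ Gⁱʲ ∂ⱼ F`. -/
def coordGrad {n : ℕ} (G : EuclideanSpace ℝ (Fin n) → Matrix (Fin n) (Fin n) ℝ)
    (F : EuclideanSpace ℝ (Fin n) → ℝ) (i : Fin n) (y : EuclideanSpace ℝ (Fin n)) : ℝ :=
  ∑ j, (G y)⁻¹ i j * coordPartial j F y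

/-- The squared length `|∇F|²`. -/
def coordGradSq {n : ℕ} (G : EuclideanSpace ℝ (Fin n) → Matrix (Fin n) (Fin n) ℝ)
    (F : EuclideanSpace ℝ (Fin n) → ℝ) (y : EuclideanSpace ℝ (Fin n)) : ℝ :=
  ∑ i, coordGrad G F i y * coordPartial i F y

/-- The mean curvature `div (∇F / |∇F|)` of the level set of `F` through `y`, with respect to the
unit normal `ν = ∇F / |∇F|`: the trace of `Hess F / |∇F|` over the orthogonal complement of `ν`.
With this sign the unit sphere of `ℝⁿ` has mean curvature `n - 1` with respect to
the normal that points away from the origin. -/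
def coordMeanCurvature {n : ℕ} (G : EuclideanSpace ℝ (Fin n) → Matrix (Fin n) (Fin n) ℝ)
    (F : EuclideanSpace ℝ (Fin n) → ℝ) (y : EuclideanSpace ℝ (Fin n)) : ℝ :=
  (∑ i, ∑ j, ((G y)⁻¹ i j - coordGrad G F i y * coordGrad G F j y / coordGradSq G F y) *
    coordHessian G F i j y) / Real.sqrt (coordGradSq G F y)

end Coordinates

/-! ### Mean curvature on a Riemannian manifold -/

/-- Smooth Riemannian metrics on a smooth `n`-manifold `M` without boundary. -/
abbrev SmoothMetric (n : ℕ) (M : Type*) [TopologicalSpace M]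
    [ChartedSpace (EuclideanSpace ℝ (Fin n)) M] [IsManifold (𝓡 n) ∞ M] :=
  Bundle.ContMDiffRiemannianMetric (𝓡 n) ∞ (EuclideanSpace ℝ (Fin n))
    (fun x : M => TangentSpace (𝓡 n) x)

section Manifold

variable {n : ℕ} {M : Type*} [TopologicalSpace M]
  [ChartedSpace (EuclideanSpace ℝ (Fin n)) M] [IsManifold (𝓡 n) ∞ M]

/-- The `i`-th coordinate vector field of the preferred chart at `p`, at the point of `M` with
coordinates `y`. -/
def chartVector (p : M) (i : Fin n) (y : EuclideanSpace ℝ (Fin n)) :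
    TangentSpace (𝓡 n) ((extChartAt (𝓡 n) p).symm y) :=
  mfderiv 𝓘(ℝ, EuclideanSpace ℝ (Fin n)) (𝓡 n) (extChartAt (𝓡 n) p).symm y
    (EuclideanSpace.single i (1 : ℝ) : EuclideanSpace ℝ (Fin n))

/-- The matrix `gᵢⱼ` of the metric in the preferred chart at `p`. -/
def chartMetric (g : SmoothMetric n M) (p : M) (y : EuclideanSpace ℝ (Fin n)) :
    Matrix (Fin n) (Fin n) ℝ :=
  Matrix.of fun i j =>
    g.inner ((extChartAt (𝓡 n) p).symm y) (chartVector p i y) (chartVector p j y)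

/-- The mean curvature at `p` of the level set of `f` through `p`, with respect to the unit
normal `∇f / |∇f|` (meaningful where `f` is smooth with nonzero differential). -/
def meanCurvature (g : SmoothMetric n M) (f : M → ℝ) (p : M) : ℝ :=
  coordMeanCurvature (chartMetric g p) (f ∘ (extChartAt (𝓡 n) p).symm) (extChartAt (𝓡 n) p p)

end Manifold

/-! ### Ends -/

/-- An end of a topological space: a compatible choice of a connected component of the complement
of every compact set. The sets `e.comp K` are the neighbourhoods of infinity of the end `e`. -/
@[ext] structure TopEnd (X : Type*) [TopologicalSpace X] where
  comp : TopologicalSpace.Compacts X → Set X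
  isComponent : ∀ K : TopologicalSpace.Compacts X,
    ∃ x ∈ (K : Set X)ᶜ, comp K = connectedComponentIn (K : Set X)ᶜ x
  anti : ∀ K L : TopologicalSpace.Compacts X, K ≤ L → comp L ⊆ comp K

section Horizon

variable {n : ℕ} {M : Type*} [TopologicalSpace M]
  [ChartedSpace (EuclideanSpace ℝ (Fin n)) M] [IsManifold (𝓡 n) ∞ M]

/-- The level sets `{t = s}`, `s > 0`, foliate a neighbourhood `{t > 0}` of the end `e` by smooth
compact connected hypersurfaces that move off to infinity in `e` as `s → ∞` and have positive mean
curvature with respect to the normal pointing towards the end. (The function `t` is extended to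
all of `M` by nonpositive values.) -/
structure IsPositiveFoliation (g : SmoothMetric n M) (e : TopEnd M) (t : M → ℝ) : Prop where
  continuous : Continuous t
  smooth : ContMDiffOn (𝓡 n) 𝓘(ℝ, ℝ) ∞ t {x | 0 < t x}
  noncritical : ∀ x, 0 < t x → mfderiv (𝓡 n) 𝓘(ℝ, ℝ) t x ≠ 0
  compact_slab : ∀ a b : ℝ, 0 < a → IsCompact (t ⁻¹' Icc a b)
  connected_leaf : ∀ s : ℝ, 0 < s → IsConnected (t ⁻¹' {s})
  tendsto_end : ∀ b : ℝ, ∃ K : TopologicalSpace.Compacts M, e.comp K ⊆ {x | b < t x}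
  meanCurvature_pos : ∀ x, 0 < t x → 0 < meanCurvature g t x

/-- `(M, g)` has positive ends: it has at least two ends, and every end is foliated by smooth
compact hypersurfaces of positive mean curvature. -/
def HasPositiveEnds (g : SmoothMetric n M) : Prop :=
  (∃ e e' : TopEnd M, e ≠ e') ∧ ∀ e : TopEnd M, ∃ t : M → ℝ, IsPositiveFoliation g e t

/-- Near the boundary point `p` the open set `R` is `{f < 0}` for a smooth function `f`
with nonzero differential at `p`. Then `∇f / |∇f|` is the normal pointing out of `R`. -/
def IsLocalDefiningFunction (n : ℕ) {M : Type*} [TopologicalSpace M]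
    [ChartedSpace (EuclideanSpace ℝ (Fin n)) M] (R : Set M) (p : M) (f : M → ℝ) : Prop :=
  ∃ U : Set M, IsOpen U ∧ p ∈ U ∧ ContMDiffOn (𝓡 n) 𝓘(ℝ, ℝ) ∞ f U ∧
    R ∩ U = {x ∈ U | f x < 0} ∧ mfderiv (𝓡 n) 𝓘(ℝ, ℝ) f p ≠ 0

/-- Marginally trapped regions relative to the distinguished end `e₀`: open sets that are
neighbourhoods of infinity of all ends but `e₀`, with `e₀` lying outside, whose boundary is compact,
smooth, and has nonpositive mean curvature with respect to the outward normal.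
(The region is recorded through its points in `M`; the points at infinity of the ends other
than `e₀` are interior to it.) -/
structure IsMarginallyTrappedRegion (g : SmoothMetric n M) (e₀ : TopEnd M) (R : Set M) :
    Prop where
  isOpen : IsOpen R
  contains_end : ∀ e : TopEnd M, e ≠ e₀ → ∃ K : TopologicalSpace.Compacts M, e.comp K ⊆ R
  avoids_end : ∃ K : TopologicalSpace.Compacts M, Disjoint (e₀.comp K) R
  compact_boundary : IsCompact (frontier R)
  boundary : ∀ p ∈ frontier R, ∃ f : M → ℝ, IsLocalDefiningFunction n R p f ∧
    meanCurvature g f p ≤ 0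

/-- The closure of the union of all marginally trapped regions. -/
def totalTrappedRegion (g : SmoothMetric n M) (e₀ : TopEnd M) : Set M :=
  closure (⋃₀ {R | IsMarginallyTrappedRegion g e₀ R})

/-- The compact set `S` encloses the end `e₀`: it separates `e₀` from every other end. -/
def Encloses {X : Type*} [TopologicalSpace X] (S : Set X) (e₀ : TopEnd X) : Prop :=
  S.Nonempty ∧ ∃ hS : IsCompact S, ∀ e : TopEnd X, e ≠ e₀ → e.comp ⟨S, hS⟩ ≠ e₀.comp ⟨S, hS⟩

/-- `S` is the apparent horizon of `(M, g)` with respect to the end `e₀`: the part of the boundary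
of the total trapped region that faces `e₀`, that is, the boundary of the component `W` of the
complement which contains the end `e₀`; and `S` encloses `e₀`. -/
def IsApparentHorizon (g : SmoothMetric n M) (e₀ : TopEnd M) (S : Set M) : Prop :=
  S ⊆ frontier (totalTrappedRegion g e₀) ∧
  (∃ W : Set M,
    (∃ x ∈ (totalTrappedRegion g e₀)ᶜ, W = connectedComponentIn (totalTrappedRegion g e₀)ᶜ x) ∧
    (∃ K : TopologicalSpace.Compacts M, e₀.comp K ⊆ W) ∧ S = frontier W) ∧
  Encloses S e₀

end Horizon

end

/-! ### Ends of topological spaces -/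

section Ends

variable {X : Type*} [TopologicalSpace X]

open TopologicalSpace

/-! The leaves of the foliations act as barriers on both sides. In an end other than `e₀`, the
normal of a leaf pointing out of the superlevel set `{t > a}` is opposite to the one pointing
towards the end. The union of these superlevels is therefore marginally trapped
(`isMarginallyTrappedRegion_iUnion_superlevels`), so the total trapped region `T` contains a
neighbourhood of every other end. Conversely, if a marginally trapped region entered `{t > 0}` in
`e₀`, then `t` would attain its maximum over the closure of the region at a boundary point, where
the boundary touches a leaf from below. Comparing mean curvatures there
(`meanCurvature_le_of_contact`) gives `0 < H_leaf ≤ H_boundary ≤ 0`. So `T` misses the connected set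
`{t > 0}`, which lies in one component `W` of the complement.

The rest is topology. The end compactification is compact (`ideal_univ_of_forall_end`), so there are
finitely many ends, and removing a superlevel from each leaves a relatively compact set. The
boundary of `W` avoids these superlevels, hence is compact. It is nonempty because `M` is connected
and `T` is nonempty, and it separates because `W` and `T` are disjoint. No regularity of the horizon
is used. -/

theorem TopEnd.nonempty_comp (e : TopEnd X) (K : Compacts X) : (e.comp K).Nonempty := by
  obtain ⟨x, hx, h⟩ := e.isComponent K
  exact ⟨x, h ▸ mem_connectedComponentIn hx⟩

theorem TopEnd.isPreconnected_comp (e : TopEnd X) (K : Compacts X) :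
    IsPreconnected (e.comp K) := by
  obtain ⟨x, -, h⟩ := e.isComponent K
  exact h ▸ isPreconnected_connectedComponentIn

theorem TopEnd.comp_subset_compl (e : TopEnd X) (K : Compacts X) :
    e.comp K ⊆ (K : Set X)ᶜ := by
  obtain ⟨x, -, h⟩ := e.isComponent K
  exact h ▸ connectedComponentIn_subset _ _

theorem TopEnd.comp_eq_of_mem (e : TopEnd X) {K : Compacts X} {x : X} (hx : x ∈ e.comp K) :
    e.comp K = connectedComponentIn (K : Set X)ᶜ x := by
  obtain ⟨y, -, h⟩ := e.isComponent K
  rw [h] at hx ⊢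
  exact connectedComponentIn_eq hx

theorem TopEnd.subset_comp_of_isPreconnected (e : TopEnd X) {K : Compacts X} {A : Set X}
    (hA : IsPreconnected A) (hAK : A ⊆ (K : Set X)ᶜ) (h : (A ∩ e.comp K).Nonempty) :
    A ⊆ e.comp K := by
  obtain ⟨x, hxA, hx⟩ := h
  rw [e.comp_eq_of_mem hx]
  exact hA.subset_connectedComponentIn hxA hAK

theorem TopEnd.disjoint_comp_of_ne {e e' : TopEnd X} {K : Compacts X}
    (h : e.comp K ≠ e'.comp K) : Disjoint (e.comp K) (e'.comp K) := by
  refine Set.disjoint_left.2 fun x hx hx' => h ?_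
  rw [e.comp_eq_of_mem hx, e'.comp_eq_of_mem hx']

theorem TopEnd.exists_disjoint_comp {e e' : TopEnd X} (h : e ≠ e') :
    ∃ K, Disjoint (e.comp K) (e'.comp K) := by
  by_contra! H
  refine h (TopEnd.ext (funext fun K => ?_))
  by_contra hK
  exact H K (disjoint_comp_of_ne hK)

theorem TopEnd.comp_inter_nonempty (e : TopEnd X) (K L : Compacts X) :
    (e.comp K ∩ e.comp L).Nonempty := by
  obtain ⟨x, hx⟩ := e.nonempty_comp (K ⊔ L)
  exact ⟨x, e.anti _ _ le_sup_left hx, e.anti _ _ le_sup_right hx⟩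

/-- The end `e` accumulates on `A`: each of its neighbourhoods of infinity meets `A`. -/
def TopEnd.AccumulatesOn (e : TopEnd X) (A : Set X) : Prop :=
  ∀ K : Compacts X, (e.comp K ∩ A).Nonempty

theorem TopEnd.AccumulatesOn.mono {e : TopEnd X} {A B : Set X} (h : e.AccumulatesOn A)
    (hAB : A ⊆ B) : e.AccumulatesOn B :=
  fun K => (h K).mono (inter_subset_inter_right _ hAB)

/-- Neighbourhoods of infinity of an end are directed: failures for `K` and `L` combine into a
failure for `K ⊔ L`. -/
theorem TopEnd.AccumulatesOn.union {e : TopEnd X} {A B : Set X} (h : e.AccumulatesOn (A ∪ B)) :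
    e.AccumulatesOn A ∨ e.AccumulatesOn B := by
  by_contra! H
  simp only [TopEnd.AccumulatesOn, not_forall] at H
  obtain ⟨⟨K, hK⟩, L, hL⟩ := H
  obtain ⟨x, hx, hxA | hxB⟩ := h (K ⊔ L)
  · exact hK ⟨x, e.anti _ _ le_sup_left hx, hxA⟩
  · exact hL ⟨x, e.anti _ _ le_sup_right hx, hxB⟩

theorem TopEnd.not_accumulatesOn_of_isCompact (e : TopEnd X) {A : Set X} (hA : IsCompact A) :
    ¬ e.AccumulatesOn A := fun h => by
  obtain ⟨x, hx, hxA⟩ := h ⟨A, hA⟩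
  exact e.comp_subset_compl _ hx hxA

/-- Compactness of the end compactification: an ideal of sets that contains the compact sets and
a neighbourhood of infinity of every end contains the whole space. -/
theorem ideal_univ_of_forall_end [T2Space X] [LocallyConnectedSpace X] [ConnectedSpace X]
    [WeaklyLocallyCompactSpace X] [SigmaCompactSpace X] (P : Set X → Prop)
    (mono : ∀ A B, A ⊆ B → P B → P A) (union : ∀ A B, P A → P B → P (A ∪ B))
    (compact : ∀ A, IsCompact A → P A) (ends : ∀ e : TopEnd X, ∃ K, P (e.comp K)) :
    P univ := by
  by_contra hP
  let L := CompactExhaustion.choice X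
  have hLc : ∀ n, IsOpen ((L n)ᶜ) := fun n => (L.isCompact n).isClosed.isOpen_compl
  -- König-type step: a set outside the ideal meets a component of `(L n)ᶜ` that is also outside the
  -- ideal. The compact frontier of `L (n + 1)` meets only finitely many components. A component
  -- reaching beyond `L (n + 1)` without meeting this frontier would be clopen, hence the whole
  -- space.
  have step : ∀ V, ¬ P V → ∀ n, ∃ x ∈ V ∩ (L n)ᶜ, ¬ P (connectedComponentIn (L n)ᶜ x) := by
    intro V hV n
    by_contra! H
    have hD : IsCompact (frontier (L (n + 1))) := (L.isCompact _).of_isClosed_subset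
      isClosed_frontier (L.isCompact _).isClosed.frontier_subset
    have hDL : frontier (L (n + 1)) ⊆ (L n)ᶜ := fun x hx hxn =>
      hx.2 (L.subset_interior_succ n hxn)
    obtain ⟨T, hTD, hT⟩ := hD.elim_nhds_subcover (fun x => connectedComponentIn (L n)ᶜ x)
      fun x hx => (hLc n).connectedComponentIn.mem_nhds (mem_connectedComponentIn (hDL hx))
    -- Only components meeting `V` are kept, since `H` says nothing about the others.
    let T' := {x ∈ (T : Set X) | (connectedComponentIn (L n)ᶜ x ∩ (V ∩ (L n)ᶜ)).Nonempty}
    have hT'fin : T'.Finite := T.finite_toSet.subset (sep_subset _ _)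
    have hPT : ∀ S : Set X, S.Finite → S ⊆ T' →
        P (⋃ x ∈ S, connectedComponentIn (L n)ᶜ x) := by
      intro S hS
      induction S, hS using Set.Finite.induction_on with
      | empty => intro _; simpa using compact ∅ isCompact_empty
      | @insert a s _ _ ih =>
        intro hs
        rw [biUnion_insert]
        refine union _ _ ?_ (ih ((subset_insert _ _).trans hs))
        obtain ⟨y, hy, hyV⟩ := (hs (mem_insert _ _)).2
        rw [connectedComponentIn_eq hy]
        exact H y hyV
    refine hV (mono _ _ ?_ (union _ _ (compact _ (L.isCompact (n + 1))) (hPT T' hT'fin subset_rfl)))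
    intro y hyV
    by_cases hy : y ∈ L (n + 1)
    · exact Or.inl hy
    right
    have hyn : y ∈ (L n)ᶜ := fun h => hy (L.subset_succ n h)
    by_cases hmeet : (connectedComponentIn (L n)ᶜ y ∩ frontier (L (n + 1))).Nonempty
    · obtain ⟨z, hz, hzD⟩ := hmeet
      obtain ⟨x, hxT, hzx⟩ := mem_iUnion₂.1 (hT hzD)
      have hxy : connectedComponentIn (L n)ᶜ x = connectedComponentIn (L n)ᶜ y := by
        rw [connectedComponentIn_eq hz, connectedComponentIn_eq hzx]
      refine mem_iUnion₂.2 ⟨x, ⟨hxT, y, ?_, hyV, hyn⟩, ?_⟩ <;>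
      exact hxy ▸ mem_connectedComponentIn hyn
    · exfalso
      have hsub : connectedComponentIn (L n)ᶜ y ⊆ (L (n + 1))ᶜ := by
        have hdisj : connectedComponentIn (L n)ᶜ y ⊆ interior (L (n + 1)) ∪ (L (n + 1))ᶜ := by
          intro z hz
          by_cases hzL : z ∈ L (n + 1)
          · left
            by_contra hzi
            exact hmeet ⟨z, hz, subset_closure hzL, hzi⟩
          · exact Or.inr hzL
        refine (isPreconnected_connectedComponentIn.subset_or_subset isOpen_interior (hLc _)
          (disjoint_compl_right.mono_left interior_subset) hdisj).resolve_left fun h => ?_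
        exact hy (interior_subset (h (mem_connectedComponentIn hyn)))
      have hcl : closure (connectedComponentIn (L n)ᶜ y) ⊆ connectedComponentIn (L n)ᶜ y := by
        refine isPreconnected_connectedComponentIn.closure.subset_connectedComponentIn
          (subset_closure (mem_connectedComponentIn hyn)) ?_
        refine (closure_mono hsub).trans ?_
        rw [closure_compl]
        exact compl_subset_compl.2 (L.subset_interior_succ n)
      have huniv : connectedComponentIn (L n)ᶜ y = univ :=
        IsClopen.eq_univ ⟨closure_subset_iff_isClosed.1 hcl, (hLc n).connectedComponentIn⟩
          ⟨y, mem_connectedComponentIn hyn⟩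
      exact hP (huniv ▸ H y ⟨hyV, hyn⟩)
  -- Iterating the step yields a decreasing sequence of components outside the ideal; it determines
  -- an end that violates `ends`.
  let S : ℕ → Type _ := fun n => {x : X // x ∈ (L n)ᶜ ∧ ¬ P (connectedComponentIn (L n)ᶜ x)}
  have hnext : ∀ n (s : S n), ∃ s' : S (n + 1), s'.1 ∈ connectedComponentIn (L n)ᶜ s.1 := by
    intro n s
    obtain ⟨x, hx, h⟩ := step _ s.2.2 (n + 1)
    exact ⟨⟨x, hx.2, h⟩, hx.1⟩
  choose next hnext using hnext
  obtain ⟨x₀, hx₀, h₀⟩ := step _ hP 0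
  let s : ∀ n, S n := fun n => Nat.rec ⟨x₀, hx₀.2, h₀⟩ next n
  let V : ℕ → Set X := fun n => connectedComponentIn (L n)ᶜ (s n).1
  have hV : Antitone V := antitone_nat_of_succ_le fun n => by
    have hmem : (s (n + 1)).1 ∈ V n := hnext n (s n)
    change connectedComponentIn _ _ ⊆ _
    refine (connectedComponentIn_mono _ (compl_subset_compl.2 (L.subset_succ n))).trans ?_
    exact (connectedComponentIn_eq hmem).symm.subset
  have hself : ∀ n, (s n).1 ∈ V n := fun n => mem_connectedComponentIn (s n).2.1
  have hN : ∀ K : Compacts X, ∃ n, (K : Set X) ⊆ L n := fun K =>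
    L.exists_superset_of_isCompact K.isCompact
  choose N hN using hN
  let C : Compacts X → Set X := fun K => connectedComponentIn (K : Set X)ᶜ (s (N K)).1
  have hVC : ∀ K, V (N K) ⊆ C K := fun K =>
    connectedComponentIn_mono _ (compl_subset_compl.2 (hN K))
  let e : TopEnd X :=
    { comp := C
      isComponent := fun K => ⟨(s (N K)).1, fun h => (s (N K)).2.1 (hN K h), rfl⟩
      anti := by
        intro K K' hK
        have h1 := hVC K (hV (le_max_left (N K) (N K')) (hself _))
        have h2 := hVC K' (hV (le_max_right (N K) (N K')) (hself _))
        change connectedComponentIn _ _ ⊆ connectedComponentIn _ _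
        rw [connectedComponentIn_eq h1, connectedComponentIn_eq h2]
        exact connectedComponentIn_mono _ (compl_subset_compl.2 hK) }
  obtain ⟨K, hK⟩ := ends e
  exact (s (N K)).2.2 (mono _ _ (hVC K) hK)

end Ends

/-! ### Comparison of mean curvatures at a point of contact -/

section Comparison

open Filter

theorem eventually_lt_of_deriv_pos {φ : ℝ → ℝ} (h : 0 < deriv φ 0) :
    ∀ᶠ s in 𝓝[>] (0 : ℝ), φ 0 < φ s := by
  have h' : 0 < deriv (fun s => φ s - φ 0) 0 := by simpa using h
  have := eventually_nhdsWithin_sign_eq_of_deriv_pos h' (by simp)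
  filter_upwards [nhdsWithin_le_nhds this, self_mem_nhdsWithin] with s hs (hs0 : 0 < s)
  rw [sub_zero, sign_pos hs0, sign_eq_one_iff] at hs
  linarith

/-- Subtracting `d / 4 * s ^ 2` leaves the second derivative `d / 2 > 0`, so the difference still
has a local minimum at `0`; the subtracted term supplies the strict inequality. -/
theorem eventually_lt_of_deriv_deriv_pos {φ : ℝ → ℝ} (hφ : ∀ᶠ s in 𝓝 (0 : ℝ), DifferentiableAt ℝ φ s)
    (h1 : deriv φ 0 = 0) {d : ℝ} (h2 : HasDerivAt (deriv φ) d 0) (hd : 0 < d) :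
    ∀ᶠ s in 𝓝[>] (0 : ℝ), φ 0 < φ s := by
  have hsq : ∀ s : ℝ, HasDerivAt (fun s : ℝ => d / 4 * s ^ 2) (d / 2 * s) s := fun s => by
    refine ((hasDerivAt_pow 2 s).const_mul (d / 4)).congr_deriv ?_
    norm_num; ring
  have hderiv : deriv (fun s => φ s - d / 4 * s ^ 2) =ᶠ[𝓝 0] fun s => deriv φ s - d / 2 * s := by
    filter_upwards [hφ] with s hs
    exact (hs.hasDerivAt.sub (hsq s)).deriv
  have hderiv2 : deriv (deriv (fun s => φ s - d / 4 * s ^ 2)) 0 = d / 2 := by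
    rw [hderiv.deriv_eq]
    have := (h2.fun_sub ((hasDerivAt_id' (0 : ℝ)).const_mul (d / 2))).deriv
    rw [this]; ring
  have hmin := isLocalMin_of_deriv_deriv_pos (f := fun s => φ s - d / 4 * s ^ 2) (x₀ := 0)
    (by rw [hderiv2]; positivity) (by rw [hderiv.self_of_nhds]; simp [h1])
    (hφ.self_of_nhds.continuousAt.sub (hsq 0).continuousAt)
  filter_upwards [nhdsWithin_le_nhds hmin, self_mem_nhdsWithin] with s hs (hs0 : 0 < s)
  have : 0 < d / 4 * s ^ 2 := by positivity
  have hs' : φ 0 - d / 4 * 0 ^ 2 ≤ φ s - d / 4 * s ^ 2 := hs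
  linarith

variable {E : Type*} [NormedAddCommGroup E] [NormedSpace ℝ E]

theorem hasDerivAt_parabola (y v w : E) (s : ℝ) :
    HasDerivAt (fun s : ℝ => y + s • v + s ^ 2 • w) (v + (2 * s) • w) s := by
  have h1 : HasDerivAt (fun s : ℝ => s • v) v s := by
    simpa using (hasDerivAt_id s).smul_const v
  have h2 : HasDerivAt (fun s : ℝ => s ^ 2 • w) ((2 * s) • w) s := by
    simpa using (hasDerivAt_pow 2 s).smul_const w
  exact (h1.const_add y).add h2

theorem tendsto_parabola (y v w : E) :
    Tendsto (fun s : ℝ => y + s • v + s ^ 2 • w) (𝓝 0) (𝓝 y) := by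
  simpa using (hasDerivAt_parabola y v w 0).continuousAt.tendsto

/-- Parabolas serve as test curves: `w` bends the curve at second order without changing its
velocity `v`. -/
theorem deriv_comp_parabola {F : E → ℝ} {y : E} (hF : ContDiffAt ℝ 2 F y) (v w : E) :
    (∀ᶠ s in 𝓝 (0 : ℝ), DifferentiableAt ℝ (fun s : ℝ => F (y + s • v + s ^ 2 • w)) s) ∧
    deriv (fun s : ℝ => F (y + s • v + s ^ 2 • w)) 0 = fderiv ℝ F y v ∧
    HasDerivAt (deriv fun s : ℝ => F (y + s • v + s ^ 2 • w))
      (fderiv ℝ (fderiv ℝ F) y v v + 2 * fderiv ℝ F y w) 0 := by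
  have hd : ∀ᶠ s in 𝓝 (0 : ℝ), HasDerivAt (fun s : ℝ => F (y + s • v + s ^ 2 • w))
      (fderiv ℝ F (y + s • v + s ^ 2 • w) (v + (2 * s) • w)) s := by
    have := (tendsto_parabola y v w).eventually (hF.eventually (by simp))
    filter_upwards [this] with s hs
    exact (hs.differentiableAt (by simp)).hasFDerivAt.comp_hasDerivAt s
      (hasDerivAt_parabola y v w s)
  refine ⟨hd.mono fun s hs => hs.differentiableAt, by simpa using hd.self_of_nhds.deriv, ?_⟩
  have h2 : HasFDerivAt (fderiv ℝ F) (fderiv ℝ (fderiv ℝ F) y)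
      (y + (0 : ℝ) • v + (0 : ℝ) ^ 2 • w) := by
    simpa using ((hF.fderiv_right (m := 1) (by norm_num)).differentiableAt
      (by simp)).hasFDerivAt
  have h3 := h2.comp_hasDerivAt (0 : ℝ) (hasDerivAt_parabola y v w 0)
  have h4 : HasDerivAt (fun s : ℝ => v + (2 * s) • w) ((2 : ℝ) • w) 0 := by
    simpa using (((hasDerivAt_id (0 : ℝ)).const_mul 2).smul_const w).const_add v
  refine ((h3.clm_apply h4).congr_deriv ?_).congr_of_eventuallyEq
    (hd.mono fun s hs => hs.deriv)
  simp

/-- If `{f < 0}` lies in `{t ≤ t y}` near the point `y` of `{f = 0}`, then `dt = c df` at `y`, and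
the second derivative of `t` is at most `c` times that of `f` along the kernel of `df`. -/
theorem exists_fderiv_eq_smul_of_contact {f t : E → ℝ} {y : E} (hf : ContDiffAt ℝ 2 f y)
    (ht : ContDiffAt ℝ 2 t y) (hfy : f y = 0) (hdf : fderiv ℝ f y ≠ 0)
    (hdt : fderiv ℝ t y ≠ 0) (h : ∀ᶠ x in 𝓝 y, f x < 0 → t x ≤ t y) :
    ∃ c : ℝ, 0 < c ∧ fderiv ℝ t y = c • fderiv ℝ f y ∧ ∀ v, fderiv ℝ f y v = 0 →
      fderiv ℝ (fderiv ℝ t) y v v ≤ c * fderiv ℝ (fderiv ℝ f) y v v := by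
  -- No test curve can enter `{f < 0}` while `t` rises above `t y`.
  have contact : ∀ v w : E, (∀ᶠ s in 𝓝[>] (0 : ℝ), f (y + s • v + s ^ 2 • w) < 0) →
      (∀ᶠ s in 𝓝[>] (0 : ℝ), t y < t (y + s • v + s ^ 2 • w)) → False := by
    intro v w h1 h2
    have h3 := nhdsWithin_le_nhds (s := Ioi (0 : ℝ)) ((tendsto_parabola y v w).eventually h)
    obtain ⟨s, hs1, hs2, hs3⟩ := (h1.and (h2.and h3)).exists
    exact (hs3 hs1).not_gt hs2
  have first : ∀ v, fderiv ℝ f y v < 0 → fderiv ℝ t y v ≤ 0 := by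
    intro v hv
    by_contra! hv'
    refine contact v 0 ?_ ?_
    · have := eventually_lt_of_deriv_pos (φ := fun s : ℝ => -f (y + s • v + s ^ 2 • (0 : E)))
        (by rw [deriv.fun_neg, (deriv_comp_parabola hf v 0).2.1]; linarith)
      filter_upwards [this] with s hs
      simpa [hfy] using hs
    · have := eventually_lt_of_deriv_pos (φ := fun s : ℝ => t (y + s • v + s ^ 2 • (0 : E)))
        (by rw [(deriv_comp_parabola ht v 0).2.1]; exact hv')
      simpa using this
  obtain ⟨u, hu⟩ : ∃ u, fderiv ℝ f y u = 1 := by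
    obtain ⟨u, hu⟩ : ∃ u, fderiv ℝ f y u ≠ 0 := by
      by_contra! H
      exact hdf (ContinuousLinearMap.ext H)
    exact ⟨(fderiv ℝ f y u)⁻¹ • u, by simp [hu]⟩
  have kerle : ∀ x, fderiv ℝ f y x = 0 → fderiv ℝ t y x ≤ 0 := by
    intro x hx
    refine le_of_forall_pos_le_add fun ε hε => ?_
    -- A kernel vector is pushed slightly into `df < 0` by a multiple of `u`, small enough to change
    -- `dt` by at most `ε`.
    have hδ : 0 < ε / (|fderiv ℝ t y u| + 1) := by positivity
    have := first (x - (ε / (|fderiv ℝ t y u| + 1)) • u) (by simp [hx, hu]; positivity)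
    simp only [map_sub, map_smul, smul_eq_mul, sub_nonpos] at this
    refine this.trans ?_
    rw [zero_add, div_mul_eq_mul_div, div_le_iff₀ (by positivity)]
    exact mul_le_mul_of_nonneg_left ((le_abs_self _).trans (by linarith)) hε.le
  have ker : ∀ x, fderiv ℝ f y x = 0 → fderiv ℝ t y x = 0 := fun x hx =>
    (kerle x hx).antisymm (by simpa using kerle (-x) (by simp [hx]))
  have hc : fderiv ℝ t y = fderiv ℝ t y u • fderiv ℝ f y := by
    ext x
    have := ker (x - fderiv ℝ f y x • u) (by simp [hu])
    simp only [map_sub, map_smul, smul_eq_mul, sub_eq_zero] at this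
    simp [this, mul_comm]
  have hc0 : 0 < fderiv ℝ t y u := by
    refine lt_of_le_of_ne ?_ fun h0 => hdt (by rw [hc, ← h0, zero_smul])
    simpa using first (-u) (by simp [hu])
  refine ⟨_, hc0, hc, fun v hv => ?_⟩
  by_contra! hlt
  set c := fderiv ℝ t y u
  -- With this `δ` and the `w` below, the second derivative along the curve is `-2δ` for `f` and
  -- `2cδ` for `t`, so the curve contradicts `contact`.
  set δ := (fderiv ℝ (fderiv ℝ t) y v v - c * fderiv ℝ (fderiv ℝ f) y v v) / (4 * c) with hδ
  have hδ0 : 0 < δ := by apply div_pos <;> linarith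
  have hcδ : 4 * (c * δ) = fderiv ℝ (fderiv ℝ t) y v v - c * fderiv ℝ (fderiv ℝ f) y v v := by
    rw [hδ]; field_simp
  set w : E := (-(fderiv ℝ (fderiv ℝ f) y v v) / 2 - δ) • u with hw
  have hfw : fderiv ℝ f y w = -(fderiv ℝ (fderiv ℝ f) y v v) / 2 - δ := by simp [hw, hu]
  have htw : fderiv ℝ t y w = c * (-(fderiv ℝ (fderiv ℝ f) y v v) / 2 - δ) := by
    rw [hc]; simp [hfw]
  obtain ⟨f1, f2, f3⟩ := deriv_comp_parabola hf v w
  obtain ⟨t1, t2, t3⟩ := deriv_comp_parabola ht v w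
  refine contact v w ?_ ?_
  · have := eventually_lt_of_deriv_deriv_pos
      (φ := fun s : ℝ => -f (y + s • v + s ^ 2 • w)) (f1.mono fun s hs => hs.fun_neg)
      (by rw [deriv.fun_neg, f2, hv, neg_zero]) (d := 2 * δ) ?_ (by positivity)
    · filter_upwards [this] with s hs
      simpa [hfy] using hs
    · rw [deriv.fun_neg']
      refine f3.fun_neg.congr_deriv ?_
      rw [hfw]; ring
  · have := eventually_lt_of_deriv_deriv_pos t1 (by rw [t2, ker v hv]) t3
      (by rw [htw]; nlinarith)
    simpa using this

end Comparison

/-! ### Mean curvature comparison in coordinates -/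

section Coordinates

variable {n : ℕ}

theorem coordPartial_coordPartial {F : EuclideanSpace ℝ (Fin n) → ℝ}
    {y : EuclideanSpace ℝ (Fin n)} (hF : ContDiffAt ℝ 2 F y) (i j : Fin n) :
    coordPartial i (coordPartial j F) y =
      fderiv ℝ (fderiv ℝ F) y (EuclideanSpace.single i 1) (EuclideanSpace.single j 1) := by
  have hd : DifferentiableAt ℝ (fderiv ℝ F) y :=
    (hF.fderiv_right (m := 1) (by norm_num)).differentiableAt (by simp)
  have := (hd.hasFDerivAt.clm_apply
    (hasFDerivAt_const (EuclideanSpace.single j (1 : ℝ)) y)).fderiv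
  unfold coordPartial
  rw [this]
  simp

theorem sum_smul_single (v : Fin n → ℝ) :
    ∑ i, v i • (EuclideanSpace.single i (1 : ℝ)) = WithLp.toLp 2 v := by
  ext j
  simp [Finset.sum_apply, Pi.single_apply]

open Matrix MatrixOrder in
/-- The inverse metric restricted to the conormal complement of `a` is a sum of squares of vectors
in the kernel of `a`. -/
theorem exists_sum_mul_eq_of_posDef {A : Matrix (Fin n) (Fin n) ℝ} (hA : A.PosDef)
    {a : Fin n → ℝ} (ha : a ≠ 0) : ∃ B : Matrix (Fin n) (Fin n) ℝ, B *ᵥ a = 0 ∧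
      ∀ i j, A i j - (A *ᵥ a) i * (A *ᵥ a) j / ((A *ᵥ a) ⬝ᵥ a) = ∑ k, B k i * B k j := by
  obtain ⟨C, hC⟩ : ∃ C : Matrix (Fin n) (Fin n) ℝ, A = Cᵀ * C := by
    obtain ⟨C, hC⟩ := CStarAlgebra.nonneg_iff_eq_star_mul_self.mp hA.posSemidef.nonneg
    exact ⟨C, by simpa [star_eq_conjTranspose] using hC⟩
  have hq : 0 < (A *ᵥ a) ⬝ᵥ a := by
    have := hA.dotProduct_mulVec_pos ha
    rwa [star_trivial, dotProduct_comm] at this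
  set q := (A *ᵥ a) ⬝ᵥ a with hq'
  have hAC : ∀ j, ∑ k, C k j * (C *ᵥ a) k = (A *ᵥ a) j := fun j => by
    rw [hC, ← mulVec_mulVec]; rfl
  have hCC : ∑ k, (C *ᵥ a) k * (C *ᵥ a) k = q := by
    have : (C *ᵥ a) ⬝ᵥ (C *ᵥ a) = q := by
      rw [hq', dotProduct_mulVec, ← mulVec_transpose, mulVec_mulVec, ← hC]
    exact this
  -- This is `C` followed by the orthogonal projection that kills `C *ᵥ a`, whose squared length is
  -- `q`.
  refine ⟨Matrix.of fun k i => C k i - (C *ᵥ a) k * (A *ᵥ a) i / q, ?_, fun i j => ?_⟩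
  · ext k
    have h1 : ∑ i, (A *ᵥ a) i * a i = q := rfl
    have h2 : ∑ i, C k i * a i = (C *ᵥ a) k := rfl
    simp only [mulVec, dotProduct, Matrix.of_apply, Pi.zero_apply]
    change ∑ i, (C k i - (C *ᵥ a) k * (A *ᵥ a) i / q) * a i = 0
    calc _ = ∑ i, C k i * a i - (C *ᵥ a) k / q * ∑ i, (A *ᵥ a) i * a i := by
          rw [Finset.mul_sum, ← Finset.sum_sub_distrib]
          exact Finset.sum_congr rfl fun i _ => by ring
      _ = 0 := by rw [h1, h2]; field_simp; ring
  · have h0 : A i j = ∑ k, C k i * C k j := by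
      conv_lhs => rw [hC]
      rfl
    simp only [Matrix.of_apply]
    calc _ = ∑ k, C k i * C k j - (A *ᵥ a) j / q * ∑ k, C k i * (C *ᵥ a) k
          - (A *ᵥ a) i / q * ∑ k, C k j * (C *ᵥ a) k
          + (A *ᵥ a) i * (A *ᵥ a) j / q ^ 2 * ∑ k, (C *ᵥ a) k * (C *ᵥ a) k := by
          rw [hAC, hAC, hCC, h0]; field_simp; ring
      _ = _ := by
          simp only [Finset.mul_sum, ← Finset.sum_sub_distrib, ← Finset.sum_add_distrib]
          exact Finset.sum_congr rfl fun k _ => by field_simp; ring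

/-- Comparison of mean curvatures: if `{f < 0}` lies in `{t ≤ t y}` near the point `y` of
`{f = 0}`, then the mean curvature of `{t = t y}` at `y` is at most that of `{f = 0}`. -/
theorem coordMeanCurvature_le_of_contact
    {G : EuclideanSpace ℝ (Fin n) → Matrix (Fin n) (Fin n) ℝ}
    {f t : EuclideanSpace ℝ (Fin n) → ℝ} {y : EuclideanSpace ℝ (Fin n)} (hG : (G y).PosDef)
    (hf : ContDiffAt ℝ 2 f y) (ht : ContDiffAt ℝ 2 t y) (hfy : f y = 0)
    (hdf : fderiv ℝ f y ≠ 0) (hdt : fderiv ℝ t y ≠ 0)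
    (h : ∀ᶠ x in 𝓝 y, f x < 0 → t x ≤ t y) :
    coordMeanCurvature G t y ≤ coordMeanCurvature G f y := by
  obtain ⟨c, hc, hdtf, hD⟩ := exists_fderiv_eq_smul_of_contact hf ht hfy hdf hdt h
  have hp : ∀ i, coordPartial i t y = c * coordPartial i f y := fun i => by
    simp [coordPartial, hdtf]
  have hgrad : ∀ i, coordGrad G t i y = c * coordGrad G f i y := fun i => by
    simp only [coordGrad, hp, Finset.mul_sum]
    exact Finset.sum_congr rfl fun j _ => by ring
  have hsq : coordGradSq G t y = c ^ 2 * coordGradSq G f y := by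
    simp only [coordGradSq, hp, hgrad, Finset.mul_sum]
    exact Finset.sum_congr rfl fun j _ => by ring
  set a : Fin n → ℝ := fun i => coordPartial i f y
  have hfa : ∀ v : Fin n → ℝ, fderiv ℝ f y (WithLp.toLp 2 v) = ∑ i, v i * a i := fun v => by
    rw [← sum_smul_single, map_sum]
    simp [a, coordPartial]
  have ha : a ≠ 0 := fun h0 => hdf <| by
    ext v
    simpa [h0] using hfa v.ofLp
  obtain ⟨B, hB, hP⟩ := exists_sum_mul_eq_of_posDef hG.inv ha
  replace hP : ∀ i j, (G y)⁻¹ i j - coordGrad G f i y * coordGrad G f j y / coordGradSq G f y =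
      ∑ k, B k i * B k j := hP
  -- The projected inverse metric is unchanged when the differential is scaled by `c`: numerator and
  -- denominator both gain `c ^ 2`.
  have hPt : ∀ i j, (G y)⁻¹ i j - coordGrad G t i y * coordGrad G t j y / coordGradSq G t y =
      ∑ k, B k i * B k j := fun i j => by
    rw [← hP, hgrad, hgrad, hsq]
    congr 1
    rw [show c * coordGrad G f i y * (c * coordGrad G f j y) =
      c ^ 2 * (coordGrad G f i y * coordGrad G f j y) by ring,
      mul_div_mul_left _ _ (by positivity)]
  have hbil : ∀ F : EuclideanSpace ℝ (Fin n) → ℝ, ContDiffAt ℝ 2 F y → ∀ v : Fin n → ℝ,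
      ∑ i, ∑ j, v i * v j * coordPartial i (coordPartial j F) y =
        fderiv ℝ (fderiv ℝ F) y (WithLp.toLp 2 v) (WithLp.toLp 2 v) := fun F hF v => by
    rw [← sum_smul_single]
    simp only [map_sum, map_smul, sum_apply, smul_apply,
      smul_eq_mul, Finset.mul_sum, coordPartial_coordPartial hF]
    rw [Finset.sum_comm]
    exact Finset.sum_congr rfl fun i _ => Finset.sum_congr rfl fun j _ => by ring
  have hswap : ∀ Q : Fin n → Fin n → ℝ, ∑ i, ∑ j, (∑ k, B k i * B k j) * Q i j =
      ∑ k, ∑ i, ∑ j, B k i * B k j * Q i j := fun Q => by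
    simp only [Finset.sum_mul]
    refine Eq.trans (Finset.sum_congr rfl fun i _ => Finset.sum_comm) Finset.sum_comm
  unfold coordMeanCurvature
  simp only [hPt, hP, hswap]
  rw [hsq, Real.sqrt_mul (by positivity), Real.sqrt_sq hc.le, ← div_div]
  refine div_le_div_of_nonneg_right ?_ (Real.sqrt_nonneg _)
  rw [div_le_iff₀ hc, Finset.sum_mul]
  -- Each row of `B` lies in the kernel of `df`, so the second-order contact inequality applies row
  -- by row; the Christoffel terms are first order and scale exactly by `c`.
  refine Finset.sum_le_sum fun k _ => ?_
  have hk : fderiv ℝ f y (WithLp.toLp 2 (B k)) = 0 := by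
    rw [hfa]; exact congrFun hB k
  have := hD _ hk
  rw [← hbil t ht, ← hbil f hf] at this
  simp only [coordHessian, hp, mul_sub, Finset.sum_sub_distrib]
  rw [sub_mul, mul_comm _ c]
  refine sub_le_sub this (le_of_eq ?_)
  simp only [Finset.mul_sum, Finset.sum_mul]
  exact Finset.sum_congr rfl fun i _ => Finset.sum_congr rfl fun j _ =>
    Finset.sum_congr rfl fun l _ => by ring

/-- Reversing the function reverses the sign of the mean curvature of its level sets. -/
theorem coordMeanCurvature_const_sub (G : EuclideanSpace ℝ (Fin n) → Matrix (Fin n) (Fin n) ℝ)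
    (F : EuclideanSpace ℝ (Fin n) → ℝ) (a : ℝ) (y : EuclideanSpace ℝ (Fin n)) :
    coordMeanCurvature G (fun z => a - F z) y = -coordMeanCurvature G F y := by
  have h1 : ∀ i, coordPartial i (fun z => a - F z) = fun z => -coordPartial i F z := fun i => by
    ext z
    simp [coordPartial, fderiv_const_sub]
  have h2 : ∀ i j, coordPartial i (coordPartial j fun z => a - F z) y =
      -coordPartial i (coordPartial j F) y := fun i j => by
    have h0 : ∀ H : EuclideanSpace ℝ (Fin n) → ℝ,
        coordPartial i (fun z => -H z) y = -coordPartial i H y := fun H => by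
      simp [coordPartial, fderiv_fun_neg]
    rw [h1, h0]
  have h3 : ∀ i, coordGrad G (fun z => a - F z) i y = -coordGrad G F i y := fun i => by
    simp [coordGrad, h1]
  have h4 : coordGradSq G (fun z => a - F z) y = coordGradSq G F y := by
    simp [coordGradSq, h1, h3]
  have h5 : ∀ i j, coordHessian G (fun z => a - F z) i j y = -coordHessian G F i j y :=
    fun i j => by
      rw [coordHessian, h2]
      simp only [coordHessian, h1, mul_neg, Finset.sum_neg_distrib]
      ring
  simp only [coordMeanCurvature, h3, h4, h5, neg_mul, mul_neg, neg_neg, Finset.sum_neg_distrib,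
    neg_div]

end Coordinates

/-! ### Transfer of the comparison to the manifold -/

section Manifold

open Filter

variable {n : ℕ} {M : Type*} [TopologicalSpace M]
  [ChartedSpace (EuclideanSpace ℝ (Fin n)) M]

theorem mfderiv_eq_fderiv_comp_extChartAt_symm {f : M → ℝ} {p : M}
    (hf : MDifferentiableAt (𝓡 n) 𝓘(ℝ, ℝ) f p) :
    mfderiv (𝓡 n) 𝓘(ℝ, ℝ) f p =
      fderiv ℝ (f ∘ (extChartAt (𝓡 n) p).symm) (extChartAt (𝓡 n) p p) := by
  rw [hf.mfderiv, ModelWithCorners.Boundaryless.range_eq_univ, fderivWithin_univ]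
  rfl

theorem ContMDiffAt.contDiffAt_comp_extChartAt_symm {f : M → ℝ} {p : M}
    (hf : ContMDiffAt (𝓡 n) 𝓘(ℝ, ℝ) ∞ f p) :
    ContDiffAt ℝ 2 (f ∘ (extChartAt (𝓡 n) p).symm) (extChartAt (𝓡 n) p p) := by
  have := (contMDiffAt_iff.1 hf).2
  rw [ModelWithCorners.Boundaryless.range_eq_univ] at this
  exact ContDiffAt.of_le this (WithTop.coe_le_coe.2 le_top)

theorem fderiv_comp_extChartAt_symm_ne_zero {f : M → ℝ} {p : M}
    (hf : mfderiv (𝓡 n) 𝓘(ℝ, ℝ) f p ≠ 0) :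
    fderiv ℝ (f ∘ (extChartAt (𝓡 n) p).symm) (extChartAt (𝓡 n) p p) ≠ 0 := by
  have hd : MDifferentiableAt (𝓡 n) 𝓘(ℝ, ℝ) f p := by
    by_contra h
    exact hf (mfderiv_zero_of_not_mdifferentiableAt h)
  rwa [mfderiv_eq_fderiv_comp_extChartAt_symm hd] at hf

theorem tendsto_extChartAt_symm (p : M) :
    Tendsto (extChartAt (𝓡 n) p).symm (𝓝 (extChartAt (𝓡 n) p p)) (𝓝 p) := by
  simpa using (continuousAt_extChartAt_symm (I := 𝓡 n) p).tendsto

/-- A function is open at a point where its differential does not vanish. -/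
theorem nhds_le_map_of_mfderiv_ne_zero {f : M → ℝ} {p : M}
    (hf : ContMDiffAt (𝓡 n) 𝓘(ℝ, ℝ) ∞ f p) (hdf : mfderiv (𝓡 n) 𝓘(ℝ, ℝ) f p ≠ 0) :
    𝓝 (f p) ≤ map f (𝓝 p) := by
  have hs := hf.contDiffAt_comp_extChartAt_symm.hasStrictFDerivAt (by simp)
  have hne := fderiv_comp_extChartAt_symm_ne_zero hdf
  have hsurj : (fderiv ℝ (f ∘ (extChartAt (𝓡 n) p).symm) (extChartAt (𝓡 n) p p)).range = ⊤ :=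
    LinearMap.range_eq_top.2 (LinearMap.surjective fun h =>
      hne (ContinuousLinearMap.coe_injective h))
  have := hs.map_nhds_eq_of_surj hsurj
  rw [Function.comp_apply, extChartAt_to_inv] at this
  rw [← this, ← map_map]
  exact map_mono (tendsto_extChartAt_symm p)

theorem mfderiv_const_sub_ne_zero {f : M → ℝ} {p : M} (a : ℝ)
    (hf : ContMDiffAt (𝓡 n) 𝓘(ℝ, ℝ) ∞ f p) (hdf : mfderiv (𝓡 n) 𝓘(ℝ, ℝ) f p ≠ 0) :
    mfderiv (𝓡 n) 𝓘(ℝ, ℝ) (fun x => a - f x) p ≠ 0 := by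
  have h1 : ContMDiffAt (𝓡 n) 𝓘(ℝ, ℝ) ∞ (fun x => a - f x) p := contMDiffAt_const.sub hf
  rw [mfderiv_eq_fderiv_comp_extChartAt_symm (h1.mdifferentiableAt (by simp))]
  have h2 := fderiv_comp_extChartAt_symm_ne_zero hdf
  have h3 := fderiv_const_sub (𝕜 := ℝ) (f := f ∘ (extChartAt (𝓡 n) p).symm)
    (x := extChartAt (𝓡 n) p p) a
  intro h4
  exact h2 (neg_eq_zero.1 (h3.symm.trans h4))

variable [IsManifold (𝓡 n) ∞ M]

theorem chartMetric_posDef (g : SmoothMetric n M) (p : M) :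
    (chartMetric g p (extChartAt (𝓡 n) p p)).PosDef := by
  have : IsManifold (𝓡 n) 1 M := IsManifold.of_le (n := ∞) (by exact_mod_cast le_top)
  set y := extChartAt (𝓡 n) p p
  have hinv : (mfderiv 𝓘(ℝ, EuclideanSpace ℝ (Fin n)) (𝓡 n)
      (extChartAt (𝓡 n) p).symm y).IsInvertible := by
    have := isInvertible_mfderivWithin_extChartAt_symm (I := 𝓡 n) (mem_extChartAt_target p)
    rwa [ModelWithCorners.Boundaryless.range_eq_univ, mfderivWithin_univ] at this
  refine Matrix.PosDef.of_dotProduct_mulVec_pos ?_ fun x hx => ?_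
  · ext i j
    exact g.symm _ _ _
  · have hv := g.pos _ (mfderiv 𝓘(ℝ, EuclideanSpace ℝ (Fin n)) (𝓡 n)
      (extChartAt (𝓡 n) p).symm y (WithLp.toLp 2 x : EuclideanSpace ℝ (Fin n))) (fun h0 => hx ?_)
    · have hsum : mfderiv 𝓘(ℝ, EuclideanSpace ℝ (Fin n)) (𝓡 n)
          (extChartAt (𝓡 n) p).symm y (WithLp.toLp 2 x : EuclideanSpace ℝ (Fin n)) =
          ∑ i, x i • chartVector p i y := by
        rw [← sum_smul_single]
        refine (map_sum (mfderiv 𝓘(ℝ, EuclideanSpace ℝ (Fin n)) (𝓡 n)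
          (extChartAt (𝓡 n) p).symm y) _ _).trans ?_
        exact Finset.sum_congr rfl fun i _ => map_smul _ _ _
      rw [hsum] at hv
      refine hv.trans_eq ?_
      simp only [map_sum, map_smul, sum_apply, smul_apply, smul_eq_mul, dotProduct,
        Matrix.mulVec, chartMetric, Matrix.of_apply, star_trivial, Finset.mul_sum]
      rw [Finset.sum_comm]
      exact Finset.sum_congr rfl fun i _ => Finset.sum_congr rfl fun j _ => by ring
    · have := hinv.injective (h0.trans (map_zero _).symm)
      exact congrArg WithLp.ofLp this

/-- Comparison principle: if `{f < 0}` lies in `{t ≤ t p}` near the point `p` of `{f = 0}`, then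
the mean curvature of `{t = t p}` at `p` is at most that of `{f = 0}`. -/
theorem meanCurvature_le_of_contact (g : SmoothMetric n M) {f t : M → ℝ} {p : M}
    (hf : ContMDiffAt (𝓡 n) 𝓘(ℝ, ℝ) ∞ f p) (ht : ContMDiffAt (𝓡 n) 𝓘(ℝ, ℝ) ∞ t p)
    (hfp : f p = 0) (hdf : mfderiv (𝓡 n) 𝓘(ℝ, ℝ) f p ≠ 0)
    (hdt : mfderiv (𝓡 n) 𝓘(ℝ, ℝ) t p ≠ 0) (h : ∀ᶠ x in 𝓝 p, f x < 0 → t x ≤ t p) :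
    meanCurvature g t p ≤ meanCurvature g f p := by
  refine coordMeanCurvature_le_of_contact (chartMetric_posDef g p)
    hf.contDiffAt_comp_extChartAt_symm ht.contDiffAt_comp_extChartAt_symm (by simpa using hfp)
    (fderiv_comp_extChartAt_symm_ne_zero hdf) (fderiv_comp_extChartAt_symm_ne_zero hdt) ?_
  filter_upwards [(tendsto_extChartAt_symm p).eventually h] with x hx
  simpa using hx

theorem meanCurvature_const_sub (g : SmoothMetric n M) (f : M → ℝ) (a : ℝ) (p : M) :
    meanCurvature g (fun x => a - f x) p = -meanCurvature g f p :=
  coordMeanCurvature_const_sub _ _ a _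

end Manifold

/-! ### Foliated ends and the barrier principle -/

section Horizon

open Filter TopologicalSpace

variable {n : ℕ} {M : Type*} [TopologicalSpace M]
  [ChartedSpace (EuclideanSpace ℝ (Fin n)) M] [IsManifold (𝓡 n) ∞ M]

namespace IsPositiveFoliation

variable {g : SmoothMetric n M} {e : TopEnd M} {t : M → ℝ}

theorem contMDiffAt
    (h : IsPositiveFoliation g e t) {p : M} (hp : 0 < t p) : ContMDiffAt (𝓡 n) 𝓘(ℝ, ℝ) ∞ t p :=
  h.smooth.contMDiffAt ((isOpen_lt continuous_const h.continuous).mem_nhds hp)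

theorem nhds_le_map
    (h : IsPositiveFoliation g e t) {p : M} (hp : 0 < t p) : 𝓝 (t p) ≤ map t (𝓝 p) :=
  nhds_le_map_of_mfderiv_ne_zero (h.contMDiffAt hp) (h.noncritical p hp)

theorem isOpen_superlevel
    (h : IsPositiveFoliation g e t) (b : ℝ) : IsOpen {x | b < t x} :=
  isOpen_lt continuous_const h.continuous

theorem isClosed_superlevel
    (h : IsPositiveFoliation g e t) (b : ℝ) : IsClosed {x | b ≤ t x} :=
  isClosed_le continuous_const h.continuous

theorem isOpen_image
    (h : IsPositiveFoliation g e t) {A : Set M} (hA : IsOpen A) (hpos : A ⊆ {x | 0 < t x}) :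
    IsOpen (t '' A) := by
  refine isOpen_iff_mem_nhds.2 ?_
  rintro _ ⟨p, hp, rfl⟩
  exact h.nhds_le_map (hpos hp) (image_mem_map (hA.mem_nhds hp))

/-- Since `t` is open on `{t > 0}`, a separation of the superlevel maps to two open sets covering
the interval `Ioi b`. They share a value `s`, and the leaf at `s` would be disconnected. -/
theorem isPreconnected_superlevel
    (h : IsPositiveFoliation g e t) {b : ℝ} (hb : 0 ≤ b) : IsPreconnected {x | b < t x} := by
  refine isPreconnected_iff_subset_of_disjoint.2 fun u v hu hv huv hdisj => ?_
  by_contra! H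
  obtain ⟨⟨x, hx, hxu⟩, y, hy, hyv⟩ := H.imp not_subset.1 not_subset.1
  have hpos : {x | b < t x} ⊆ {x | 0 < t x} := fun z hz => hb.trans_lt hz
  have hcov : Ioi b ⊆ t '' ({x | b < t x} ∩ u) ∪ t '' ({x | b < t x} ∩ v) := by
    intro s hs
    obtain ⟨z, hz⟩ := (h.connected_leaf s (hb.trans_lt hs)).nonempty
    have hz' : b < t z := by rw [show t z = s from hz]; exact hs
    exact (huv hz').imp (fun hzu => ⟨z, ⟨hz', hzu⟩, hz⟩) fun hzv => ⟨z, ⟨hz', hzv⟩, hz⟩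
  obtain ⟨s, hs, ⟨x₁, ⟨hx₁, hx₁u⟩, hx₁s⟩, x₂, ⟨hx₂, hx₂v⟩, hx₂s⟩ := isPreconnected_Ioi _ _
    (h.isOpen_image ((h.isOpen_superlevel b).inter hu) (inter_subset_left.trans hpos))
    (h.isOpen_image ((h.isOpen_superlevel b).inter hv) (inter_subset_left.trans hpos)) hcov
    ⟨t y, hy, y, ⟨hy, (huv hy).resolve_right hyv⟩, rfl⟩
    ⟨t x, hx, x, ⟨hx, (huv hx).resolve_left hxu⟩, rfl⟩
  have hleaf : t ⁻¹' {s} ⊆ {x | b < t x} := fun z (hz : t z = s) => by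
    exact (show s ∈ Ioi b from hs).trans_eq hz.symm
  obtain ⟨z, hz, hzuv⟩ := (h.connected_leaf s (hb.trans_lt hs)).isPreconnected u v hu hv
    (hleaf.trans huv) ⟨x₁, hx₁s, hx₁u⟩ ⟨x₂, hx₂s, hx₂v⟩
  exact (hdisj.subset ⟨hleaf hz, hzuv⟩ : z ∈ (∅ : Set M))

theorem exists_superlevel_subset_comp
    (h : IsPositiveFoliation g e t) (K : Compacts M) : ∃ b, 0 < b ∧ {x | b < t x} ⊆ e.comp K := by
  obtain ⟨b, hb⟩ := K.isCompact.bddAbove_image h.continuous.continuousOn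
  obtain ⟨K', hK'⟩ := h.tendsto_end (max b 1)
  refine ⟨max b 1, by positivity, ?_⟩
  refine e.subset_comp_of_isPreconnected (h.isPreconnected_superlevel (by positivity))
    (fun x hx hxK => ?_) ?_
  · exact (hb (mem_image_of_mem t hxK)).not_gt ((le_max_left _ _).trans_lt hx)
  · obtain ⟨x, hx, hx'⟩ := e.comp_inter_nonempty K K'
    exact ⟨x, hK' hx', hx⟩

/-- A superlevel is a compact slab, where no end accumulates, together with a higher superlevel,
which lies in a neighbourhood of `e` disjoint from one of `e'`. -/
theorem eq_of_accumulatesOn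
    (h : IsPositiveFoliation g e t) {e' : TopEnd M} {b : ℝ} (hb : 0 < b)
    (he' : e'.AccumulatesOn {x | b < t x}) : e' = e := by
  by_contra hne
  obtain ⟨K, hK⟩ := TopEnd.exists_disjoint_comp hne
  obtain ⟨b', -, hb'⟩ := h.exists_superlevel_subset_comp K
  have hsub : {x | b < t x} ⊆ t ⁻¹' Icc b b' ∪ {x | b' < t x} := fun x (hx : b < t x) =>
    (le_or_gt (t x) b').imp (fun hx' => ⟨hx.le, hx'⟩) id
  rcases (he'.mono hsub).union with h1 | h1
  · exact e'.not_accumulatesOn_of_isCompact (h.compact_slab b b' hb) h1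
  · obtain ⟨x, hx, hx'⟩ := h1 K
    exact hK.le_bot ⟨hx, hb' hx'⟩

/-- Barrier principle: marginally trapped regions do not enter the foliated neighbourhood of the
distinguished end. -/
theorem disjoint_of_isMarginallyTrappedRegion
    (h : IsPositiveFoliation g e t) {R : Set M}
    (hR : IsMarginallyTrappedRegion g e R) : Disjoint R {x | 0 < t x} := by
  refine Set.disjoint_left.2 fun x hxR (hx : 0 < t x) => ?_
  obtain ⟨K, hK⟩ := hR.avoids_end
  obtain ⟨b, -, hb⟩ := h.exists_superlevel_subset_comp K
  have hRb : closure R ⊆ {x | t x ≤ b} := by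
    refine closure_minimal (fun z hz => show t z ≤ b from not_lt.1 fun hbz => ?_)
      (isClosed_le h.continuous continuous_const)
    exact hK.le_bot ⟨hb hbz, hz⟩
  have hC : IsCompact (t ⁻¹' Icc (t x) b ∩ closure R) :=
    (h.compact_slab _ _ hx).inter_right isClosed_closure
  obtain ⟨p, ⟨hpI, hpR⟩, hmax⟩ := hC.exists_isMaxOn
    ⟨x, ⟨le_rfl, hRb (subset_closure hxR)⟩, subset_closure hxR⟩ h.continuous.continuousOn
  have hp : 0 < t p := hx.trans_le hpI.1
  have hle : ∀ z ∈ R, t z ≤ t p := fun z hz => by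
    by_contra! hlt
    exact (hmax ⟨⟨hpI.1.trans hlt.le, hRb (subset_closure hz)⟩, subset_closure hz⟩).not_gt hlt
  -- Since `t` is an open map near `p`, a point of the open set `R` cannot maximize `t` over `R`.
  have hpnR : p ∉ R := fun hpR' => by
    have h1 : ∀ᶠ s in 𝓝 (t p), s ∈ t '' R :=
      h.nhds_le_map hp (image_mem_map (hR.isOpen.mem_nhds hpR'))
    obtain ⟨s, ⟨z, hz, rfl⟩, hs⟩ :=
      ((h1.filter_mono nhdsWithin_le_nhds).and (self_mem_nhdsWithin (s := Ioi (t p)))).exists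
    exact (hle z hz).not_gt hs
  obtain ⟨f, ⟨U, hU, hpU, hfs, hRU, hdf⟩, hfH⟩ := hR.boundary p
    ⟨hpR, fun hi => hpnR (interior_subset hi)⟩
  have hf : ContMDiffAt (𝓡 n) 𝓘(ℝ, ℝ) ∞ f p := hfs.contMDiffAt (hU.mem_nhds hpU)
  have hfp : f p = 0 := by
    rcases lt_trichotomy (f p) 0 with hlt | heq | hgt
    · exact absurd (hRU.superset ⟨hpU, hlt⟩).1 hpnR
    · exact heq
    · obtain ⟨z, ⟨hz1, hz2⟩, hz3⟩ := mem_closure_iff_nhds.1 hpR _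
        (inter_mem (hf.continuousAt.eventually (lt_mem_nhds hgt)) (hU.mem_nhds hpU))
      exact absurd (hRU.subset ⟨hz3, hz2⟩).2 (not_lt.2 (le_of_lt hz1))
  refine ((h.meanCurvature_pos p hp).trans_le
    (meanCurvature_le_of_contact g hf (h.contMDiffAt hp) hfp hdf (h.noncritical p hp) ?_)).not_ge hfH
  filter_upwards [hU.mem_nhds hpU] with z hzU hz
  exact hle z (hRU.superset ⟨hzU, hz⟩).1

theorem disjoint_totalTrappedRegion
    (h : IsPositiveFoliation g e t) : Disjoint (totalTrappedRegion g e) {x | 0 < t x} := by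
  refine Disjoint.closure_left ?_ (h.isOpen_superlevel 0)
  exact disjoint_sUnion_left.2 fun R hR => h.disjoint_of_isMarginallyTrappedRegion hR

end IsPositiveFoliation

end Horizon

/-! ### Finitely many ends and a marginally trapped region -/

section Existence

open Filter TopologicalSpace

variable {n : ℕ} {M : Type*} [TopologicalSpace M]
  [ChartedSpace (EuclideanSpace ℝ (Fin n)) M] [IsManifold (𝓡 n) ∞ M]
  {g : SmoothMetric n M} {t : TopEnd M → M → ℝ}

section

variable [T2Space M] [LocallyConnectedSpace M] [ConnectedSpace M] [WeaklyLocallyCompactSpace M]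
  [SigmaCompactSpace M]

/-- A manifold all of whose ends are foliated by compact hypersurfaces has finitely many ends. -/
theorem finite_topEnd_of_isPositiveFoliation (ht : ∀ e, IsPositiveFoliation g e (t e)) :
    Finite (TopEnd M) := by
  -- The ideal consists of the sets on which only finitely many ends accumulate; a superlevel of `t
  -- e` admits only `e` itself.
  have hfin : {e : TopEnd M | e.AccumulatesOn univ}.Finite := by
    refine ideal_univ_of_forall_end (fun A => {e : TopEnd M | e.AccumulatesOn A}.Finite)
      (fun A B hAB hB => hB.subset fun e he => TopEnd.AccumulatesOn.mono he hAB)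
      (fun A B hA hB => (hA.union hB).subset fun e he => TopEnd.AccumulatesOn.union he)
      (fun A hA => ?_) fun e => ?_
    · exact finite_empty.subset fun e he => e.not_accumulatesOn_of_isCompact hA he
    · obtain ⟨K, hK⟩ := (ht e).tendsto_end 1
      exact ⟨K, (finite_singleton e).subset fun e' he' =>
        (ht e).eq_of_accumulatesOn one_pos (TopEnd.AccumulatesOn.mono he' hK)⟩
  refine Set.finite_univ_iff.1 (hfin.subset fun e _ K => ?_)
  rw [inter_univ]
  exact e.nonempty_comp K

/-- The complement of neighbourhoods of infinity of all ends is contained in a compact set. -/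
theorem exists_compact_union_superlevels (ht : ∀ e, IsPositiveFoliation g e (t e))
    (a : TopEnd M → ℝ) : ∃ C : Set M, IsCompact C ∧ ∀ x, x ∈ C ∨ ∃ e, a e < t e x := by
  obtain ⟨C, hC, h⟩ : ∃ C : Set M, IsCompact C ∧ ∀ x ∈ univ, x ∈ C ∨ ∃ e, a e < t e x := by
    refine ideal_univ_of_forall_end
      (fun A => ∃ C : Set M, IsCompact C ∧ ∀ x ∈ A, x ∈ C ∨ ∃ e, a e < t e x) ?_ ?_ ?_ ?_
    · rintro A B hAB ⟨C, hC, h⟩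
      exact ⟨C, hC, fun x hx => h x (hAB hx)⟩
    · rintro A B ⟨C, hC, h⟩ ⟨D, hD, h'⟩
      exact ⟨C ∪ D, hC.union hD, fun x hx => hx.elim
        (fun hx => (h x hx).imp_left Or.inl) fun hx => (h' x hx).imp_left Or.inr⟩
    · exact fun A hA => ⟨A, hA, fun x hx => Or.inl hx⟩
    · intro e
      obtain ⟨K, hK⟩ := (ht e).tendsto_end (a e)
      exact ⟨K, ∅, isCompact_empty, fun x hx => Or.inr ⟨e, hK hx⟩⟩
  exact ⟨C, hC, fun x => h x (mem_univ x)⟩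

end

theorem exists_pairwise_disjoint_superlevels [Finite (TopEnd M)]
    (ht : ∀ e, IsPositiveFoliation g e (t e)) :
    ∃ a, 0 < a ∧ ∀ e e', e ≠ e' → Disjoint {x | a ≤ t e x} {x | a ≤ t e' x} := by
  have key : ∀ p : TopEnd M × TopEnd M, ∃ b, p.1 ≠ p.2 →
      Disjoint {x | b < t p.1 x} {x | b < t p.2 x} := by
    rintro ⟨e, e'⟩
    by_cases hne : e = e'
    · exact ⟨0, fun h => absurd hne h⟩
    obtain ⟨K, hK⟩ := TopEnd.exists_disjoint_comp hne
    obtain ⟨b, -, hb⟩ := (ht e).exists_superlevel_subset_comp K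
    obtain ⟨b', -, hb'⟩ := (ht e').exists_superlevel_subset_comp K
    exact ⟨max b b', fun _ => hK.mono
      (Subset.trans (fun x hx => (le_max_left b b').trans_lt hx) hb)
      (Subset.trans (fun x hx => (le_max_right b b').trans_lt hx) hb')⟩
  choose b hb using key
  obtain ⟨B, hB⟩ := Finite.exists_le b
  -- The `max` with `0` makes the threshold positive, and `+ 1` puts the closed superlevels inside
  -- the open ones already separated. Disjoint closed superlevels keep the boundary leaf of one end
  -- away from the others.
  refine ⟨max B 0 + 1, by positivity, fun e e' hne => (hb (e, e') hne).mono ?_ ?_⟩ <;>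
  · intro x (hx : max B 0 + 1 ≤ _)
    exact (((hB _).trans (le_max_left B 0)).trans_lt (lt_add_one _)).trans_le hx

/-- The union of foliated neighbourhoods of all ends but the distinguished one is marginally
trapped. -/
theorem isMarginallyTrappedRegion_iUnion_superlevels [Finite (TopEnd M)]
    (ht : ∀ e, IsPositiveFoliation g e (t e)) {a : ℝ} (ha : 0 < a)
    (hdisj : ∀ e e', e ≠ e' → Disjoint {x | a ≤ t e x} {x | a ≤ t e' x}) (e₀ : TopEnd M) :
    IsMarginallyTrappedRegion g e₀ (⋃ e ∈ {e | e ≠ e₀}, {x | a < t e x}) := by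
  set R : Set M := ⋃ e ∈ {e | e ≠ e₀}, {x | a < t e x} with hR
  have hRo : IsOpen R := isOpen_biUnion fun e _ => (ht e).isOpen_superlevel a
  have hmem : ∀ x, x ∈ R ↔ ∃ e, e ≠ e₀ ∧ a < t e x := fun x => by simp [hR]
  -- Finiteness of the ends makes the union of closed superlevels closed, so the frontier lies on
  -- the leaves `t e = a`.
  have hfr : ∀ p ∈ frontier R, ∃ e, e ≠ e₀ ∧ t e p = a := by
    intro p hp
    have hcl : closure R ⊆ ⋃ e ∈ {e | e ≠ e₀}, {x | a ≤ t e x} :=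
      closure_minimal (iUnion₂_mono fun e _ x (hx : a < t e x) => hx.le)
        ((Set.toFinite _).isClosed_biUnion fun e _ => (ht e).isClosed_superlevel a)
    obtain ⟨e, he, hpe⟩ := mem_iUnion₂.1 (hcl hp.1)
    refine ⟨e, he, le_antisymm (not_lt.1 fun hlt => hp.2 ?_) hpe⟩
    rw [hRo.interior_eq]
    exact (hmem p).2 ⟨e, he, hlt⟩
  refine ⟨hRo, fun e he => ?_, ?_, ?_, fun p hp => ?_⟩
  · obtain ⟨K, hK⟩ := (ht e).tendsto_end a
    exact ⟨K, fun x hx => (hmem x).2 ⟨e, he, hK hx⟩⟩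
  · obtain ⟨K, hK⟩ := (ht e₀).tendsto_end a
    refine ⟨K, Set.disjoint_left.2 fun x hx hxR => ?_⟩
    obtain ⟨e, he, hxe⟩ := (hmem x).1 hxR
    have hx₀ : a < t e₀ x := hK hx
    exact Set.disjoint_left.1 (hdisj e e₀ he) hxe.le hx₀.le
  · refine IsCompact.of_isClosed_subset (s := ⋃ e, t e ⁻¹' Icc a a)
      (isCompact_iUnion fun e => (ht e).compact_slab a a ha) isClosed_frontier fun p hp => ?_
    obtain ⟨e, -, hpe⟩ := hfr p hp
    exact mem_iUnion.2 ⟨e, hpe.ge, hpe.le⟩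
  · obtain ⟨e, he, hpe⟩ := hfr p hp
    have hp0 : 0 < t e p := by rwa [hpe]
    have hother : ∀ e', e' ≠ e → t e' p < a := fun e' he' => by
      by_contra! hle
      exact Set.disjoint_left.1 (hdisj e' e he') hle hpe.ge
    -- The neighbourhood excludes the superlevels of all other ends, so there the region is just `{a
    -- - t e < 0}`; the reversed sign makes the curvature negative.
    refine ⟨fun x => a - t e x, ⟨{x | 0 < t e x} ∩ ⋂ e' ∈ {e' | e' ≠ e}, {x | t e' x < a},
      ?_, ⟨hp0, mem_iInter₂.2 hother⟩, ?_, ?_,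
      mfderiv_const_sub_ne_zero a ((ht e).contMDiffAt hp0) ((ht e).noncritical p hp0)⟩, ?_⟩
    · exact ((ht e).isOpen_superlevel 0).inter ((Set.toFinite _).isOpen_biInter fun e' _ =>
        isOpen_lt (ht e').continuous continuous_const)
    · exact contMDiffOn_const.sub ((ht e).smooth.mono inter_subset_left)
    · ext x
      constructor
      · rintro ⟨hxR, hx0, hxU⟩
        obtain ⟨e', -, hxe'⟩ := (hmem x).1 hxR
        obtain rfl : e' = e := by
          by_contra hne
          exact lt_asymm hxe' (mem_iInter₂.1 hxU e' hne)
        exact ⟨⟨hx0, hxU⟩, sub_neg.2 hxe'⟩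
      · rintro ⟨hxU, hx⟩
        exact ⟨(hmem x).2 ⟨e, he, sub_neg.1 hx⟩, hxU⟩
    · rw [meanCurvature_const_sub]
      exact neg_nonpos.2 ((ht e).meanCurvature_pos p hp0).le

end Existence

/-! ### Boundaries of complementary components -/

section Topology

variable {X : Type*} [TopologicalSpace X]

/-- The boundary of a component of the complement of a closed set lies in the boundary of that
set. -/
theorem frontier_connectedComponentIn_compl_subset [LocallyConnectedSpace X] {T : Set X}
    (hT : IsClosed T) (x : X) : frontier (connectedComponentIn Tᶜ x) ⊆ frontier T := by
  intro y hy
  have hWo : IsOpen (connectedComponentIn Tᶜ x) := hT.isOpen_compl.connectedComponentIn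
  have hyT : y ∈ T := by
    by_contra hyT
    obtain ⟨z, hz, hzx⟩ := mem_closure_iff_nhds.1 hy.1 _
      ((hT.isOpen_compl.connectedComponentIn (x := y)).mem_nhds (mem_connectedComponentIn hyT))
    refine hy.2 ?_
    rw [hWo.interior_eq, connectedComponentIn_eq hzx, ← connectedComponentIn_eq hz]
    exact mem_connectedComponentIn hyT
  rw [hT.frontier_eq]
  refine ⟨hyT, fun hyi => ?_⟩
  have h1 : y ∈ closure Tᶜ := closure_mono (connectedComponentIn_subset _ _) hy.1
  rw [closure_compl] at h1
  exact h1 hyi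

end Topology

/-! ### Existence of the apparent horizon -/

theorem mainTheorem11 (n : ℕ) {M : Type*} [TopologicalSpace M] [T2Space M]
    [SecondCountableTopology M] [ConnectedSpace M]
    [ChartedSpace (EuclideanSpace ℝ (Fin n)) M] [IsManifold (𝓡 n) ∞ M]
    (g : SmoothMetric n M) (hg : HasPositiveEnds g) (e₀ : TopEnd M) :
    ∃ S : Set M, IsApparentHorizon g e₀ S := by
  have := ChartedSpace.locallyCompactSpace (EuclideanSpace ℝ (Fin n)) M
  have := ChartedSpace.locallyConnectedSpace (EuclideanSpace ℝ (Fin n)) M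
  obtain ⟨hne, hfol⟩ := hg
  choose t ht using hfol
  have := finite_topEnd_of_isPositiveFoliation ht
  obtain ⟨a, ha, hdisj⟩ := exists_pairwise_disjoint_superlevels ht
  have hR := isMarginallyTrappedRegion_iUnion_superlevels ht ha hdisj e₀
  set T := totalTrappedRegion g e₀ with hTdef
  have hTc : IsClosed T := isClosed_closure
  have hT0 : Disjoint T {x | 0 < t e₀ x} := (ht e₀).disjoint_totalTrappedRegion
  have hsup : ∀ e, e ≠ e₀ → {x | a < t e x} ⊆ T := fun e he x hx =>
    subset_closure ⟨_, hR, mem_iUnion₂.2 ⟨e, he, hx⟩⟩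
  obtain ⟨x₀, hx₀⟩ := ((ht e₀).connected_leaf 1 one_pos).nonempty
  replace hx₀ : 0 < t e₀ x₀ := one_pos.trans_eq (Eq.symm hx₀)
  have hx₀T : x₀ ∈ Tᶜ := fun h => Set.disjoint_left.1 hT0 h hx₀
  set W := connectedComponentIn Tᶜ x₀ with hW
  have hWo : IsOpen W := hTc.isOpen_compl.connectedComponentIn
  have hx₀W : x₀ ∈ W := mem_connectedComponentIn hx₀T
  have hpos : {x | 0 < t e₀ x} ⊆ W :=
    ((ht e₀).isPreconnected_superlevel le_rfl).subset_connectedComponentIn hx₀ fun x hx hxT =>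
      Set.disjoint_left.1 hT0 hxT hx
  have hST : frontier W ⊆ frontier T := frontier_connectedComponentIn_compl_subset hTc x₀
  obtain ⟨K₀, hK₀⟩ := (ht e₀).tendsto_end 0
  -- Far out in `e₀` points are interior to `W`, and far out in the other ends they are interior to
  -- `T`; neither can lie on the frontier of `W`.
  have hScompact : IsCompact (frontier W) := by
    obtain ⟨C, hC, hcov⟩ := exists_compact_union_superlevels ht fun _ => a
    refine hC.of_isClosed_subset isClosed_frontier fun x hx => (hcov x).resolve_right ?_
    rintro ⟨e, hxe⟩
    by_cases he : e = e₀
    · subst he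
      rw [hWo.frontier_eq] at hx
      exact hx.2 (hpos (ha.trans hxe))
    · exact (hST hx).2 (interior_maximal (hsup e he) ((ht e).isOpen_superlevel a) hxe)
  -- The second end serves only to make `T`, and hence the frontier of `W`, nonempty.
  obtain ⟨e₁, he₁⟩ : ∃ e, e ≠ e₀ := by
    obtain ⟨e, e', hee⟩ := hne
    by_cases h : e = e₀
    · exact ⟨e', fun h' => hee (h.trans h'.symm)⟩
    · exact ⟨e, h⟩
  have hSne : (frontier W).Nonempty := by
    rw [nonempty_iff_ne_empty]
    intro hS
    have huniv : W = univ := (isClopen_iff_frontier_eq_empty.2 hS).eq_univ ⟨x₀, hx₀W⟩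
    obtain ⟨K, hK⟩ := (ht e₁).tendsto_end a
    obtain ⟨y, hy⟩ := e₁.nonempty_comp K
    exact connectedComponentIn_subset Tᶜ x₀ (huniv.superset (mem_univ y)) (hsup e₁ he₁ (hK hy))
  refine ⟨frontier W, hST, ⟨W, ⟨x₀, hx₀T, rfl⟩, ⟨K₀, hK₀.trans hpos⟩, rfl⟩, hSne, hScompact,
    fun e he heq => ?_⟩
  set S : TopologicalSpace.Compacts M := ⟨frontier W, hScompact⟩
  -- A connected set missing the frontier of `W` lies in `W` or outside its closure; meeting `{t >
  -- 0}` decides which.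
  have hsub : e₀.comp S ⊆ W := by
    refine ((e₀.isPreconnected_comp S).subset_or_subset hWo isClosed_closure.isOpen_compl
      (disjoint_compl_right.mono_left subset_closure) fun x hx => ?_).resolve_right fun h => ?_
    · by_contra hxW
      rw [mem_union, not_or, notMem_compl_iff] at hxW
      refine e₀.comp_subset_compl S hx ?_
      change x ∈ frontier W
      rw [hWo.frontier_eq]
      exact ⟨hxW.2, hxW.1⟩
    · obtain ⟨x, hx, hx'⟩ := e₀.comp_inter_nonempty S K₀
      exact h hx (subset_closure (hpos (hK₀ hx')))
  -- If the two components agreed, points of `T` far out in `e` would lie in `W`.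
  obtain ⟨K, hK⟩ := (ht e).tendsto_end a
  obtain ⟨x, hx, hx'⟩ := e.comp_inter_nonempty S K
  exact connectedComponentIn_subset Tᶜ x₀ (hsub (heq.subset hx)) (hsup e he (hK hx'))
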